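/- An algebra $\mathbf A$ is a set $A$ with a family of finitary operations. Its $m$-ary polynomial functions, which form the set $\mathrm{Pol}_m(\mathbf A)$, are the functions $A^m\to A$ induced by terms built from variables, the fundamental operations of $\mathbf A$ and constants from $A$. For congruences $\theta_1,\dots,\theta_k,\beta$ of $\mathbf A$, the commutator $[\theta_1,\dots,\theta_k,\beta]$ is the smallest congruence $\delta$ of $\mathbf A$ with the following property: for all polynomial functions $f(x_1,\dots,x_k,y)$ in $k+1$ blocks of variables (of arbitrary finite lengths) and all vectors $a_i\equiv_{\theta_i}b_i$ $(1\le i\le k)$ and $c\equiv_\beta d$ of the corresponding lengths, if $f(x_1,\dots,x_k,c)\equiv_\delta f(x_1,\dots,x_k,d)$ holds for each of the $2^k-1$ ways to choose, for every $i$, $x_i$ as either $a_i$ or $b_i$, other than choosing $b_i$ for every $i$, then $f(b_1,\dots,b_k,c)\equiv_\delta f(b_1,\dots,b_k,d)$. The algebra $\mathbf A$ is $k$-supernilpotent if the commutator $[1_A,\dots,1_A]$ with $k+1$ entries equals $0_A$, where $1_A$ is the total congruence and $0_A$ is the equality relation. An expanded elementary abelian group is an algebra $\mathbf A=(A,+,-,0,(f_i)_{i\in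 S})$ such that $(A,+,-,0)$ is an abelian group all of whose nonzero elements have the same prime order; the $f_i$ are arbitrary finitary operations on $A$. **Theorem.** Let $k,n,s,\alpha\ge 1$ be integers, let $p$ be a prime, and let $\mathbf A$ be a $k$-supernilpotent expanded elementary abelian group of order $p^\alpha$. Let $f_1,\dots,f_s\in\mathrm{Pol}_n(\mathbf A)$, let $F=(f_1,\dots,f_s)\colon A^n\to A^s$, and let $a\in A^n$. For $U\subseteq\{1,\dots,n\}$ let $a^{(U)}\in A^n$ be the vector with $a^{(U)}(j)=a(j)$ for $j\in U$ and $a^{(U)}(j)=0$ for $j\notin U$. Then there is $U\subseteq\{1,\dots,n\}$ with $|U|\le k\,s\,\alpha\,(p-1)$ such that $F(a)=F(a^{(U)})$. -/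

import Mathlib

/-! Congruences, polynomial functions, higher commutators and supernilpotency of algebras.
An algebra is a set `A` with a structure for a first-order language `L` (whose function symbols are
the operation symbols of the algebra). -/

namespace UAlg

universe u v w

section General

variable (L : FirstOrder.Language.{u, v}) (A : Type w) [L.Structure A]

/-- A congruence relation: an equivalence relation compatible with all fundamental operations. -/
@[ext]
structure Congruence extends Setoid A where
  compat : ∀ {n : ℕ} (f : L.Functions n) (x y : Fin n → A), (∀ i, r (x i) (y i)) →
    r (FirstOrder.Language.Structure.funMap f x) (FirstOrder.Language.Structure.funMap f y)

/-- The largest congruence `1_A`. -/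
def Congruence.total : Congruence L A where
  r _ _ := True
  iseqv := ⟨fun _ => trivial, fun _ => trivial, fun _ _ => trivial⟩
  compat _ _ _ _ := trivial

/-- The smallest congruence `0_A`, the equality relation. -/
def Congruence.equality : Congruence L A where
  r x y := x = y
  iseqv := ⟨fun _ => rfl, fun h => h.symm, fun h h' => h.trans h'⟩
  compat f _ _ h := congrArg (FirstOrder.Language.Structure.funMap f) (funext h)

/-- Polynomial functions in variables indexed by `ι`: the functions induced by terms in the language
that has an additional constant symbol for every element of `A`. -/
def Pol (ι : Type) : Set ((ι → A) → A) :=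
  {f | ∃ t : (L.withConstants A).Term ι, ∀ x : ι → A, f x = t.realize x}

/-- The polynomial maps from `A ^ n` to `A ^ s`. -/
def PolMap (n s : ℕ) : Set ((Fin n → A) → (Fin s → A)) :=
  {F | ∀ r : Fin s, (fun x => F x r) ∈ Pol L A (Fin n)}

variable {L A}

/-- `θ 0, …, θ (n - 1)` centralize `β` modulo `δ`: let `f (x₀, …, xₙ₋₁, y)` be a polynomial function
in `n + 1` blocks of variables, let `a i`, `b i` be `θ i`-congruent and `c`, `d` be `β`-congruent
vectors. If `f (x₀, …, xₙ₋₁, c)` and `f (x₀, …, xₙ₋₁, d)` are `δ`-congruent for every choice of each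
`x i` as one of `a i`, `b i` other than choosing `b i` for all `i`, then they are also `δ`-congruent
for the choice `b 0, …, b (n - 1)`. Here `T` is the set of those `i` for which `b i` is chosen. -/
def Centralizes {n : ℕ} (θ : Fin n → Congruence L A) (β δ : Congruence L A) : Prop :=
  ∀ (m : Fin n → ℕ) (l : ℕ) (f : (((i : Fin n) × Fin (m i)) ⊕ Fin l → A) → A)
    (a b : (i : Fin n) → Fin (m i) → A) (c d : Fin l → A),
    f ∈ Pol L A (((i : Fin n) × Fin (m i)) ⊕ Fin l) →
    (∀ i j, (θ i).r (a i j) (b i j)) →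
    (∀ j, β.r (c j) (d j)) →
    (∀ T : Finset (Fin n), T ≠ Finset.univ →
      δ.r (f (Sum.elim (fun q => if q.1 ∈ T then b q.1 q.2 else a q.1 q.2) c))
        (f (Sum.elim (fun q => if q.1 ∈ T then b q.1 q.2 else a q.1 q.2) d))) →
    δ.r (f (Sum.elim (fun q => b q.1 q.2) c)) (f (Sum.elim (fun q => b q.1 q.2) d))

/-- The `(n + 1)`-ary higher commutator `[θ 0, …, θ (n - 1), β]`: the intersection of all congruences
`δ` modulo which `θ 0, …, θ (n - 1)` centralize `β`; by the two facts below it is the smallest one. -/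
def higherCommutator {n : ℕ} (θ : Fin n → Congruence L A) (β : Congruence L A) :
    Congruence L A where
  r x y := ∀ δ : Congruence L A, Centralizes θ β δ → δ.r x y
  iseqv := ⟨fun x δ _ => δ.iseqv.refl x, fun h δ hδ => δ.iseqv.symm (h δ hδ),
    fun h h' δ hδ => δ.iseqv.trans (h δ hδ) (h' δ hδ)⟩
  compat f x y h δ hδ := δ.compat f x y fun i => h i δ hδ

theorem centralizes_higherCommutator {n : ℕ} (θ : Fin n → Congruence L A) (β : Congruence L A) :
    Centralizes θ β (higherCommutator θ β) :=
  fun m l f a b c d hf hab hcd h δ hδ =>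
    hδ m l f a b c d hf hab hcd fun T hT => h T hT δ hδ

theorem higherCommutator_le {n : ℕ} (θ : Fin n → Congruence L A) (β δ : Congruence L A)
    (hδ : Centralizes θ β δ) {x y : A} (h : (higherCommutator θ β).r x y) : δ.r x y :=
  h δ hδ

variable (L A)

/-- `A` is `k`-supernilpotent: the commutator `[1_A, …, 1_A]` with `k + 1` entries is `0_A`. -/
def IsSupernilpotent (k : ℕ) : Prop :=
  higherCommutator (fun _ : Fin k => Congruence.total L A) (Congruence.total L A) =
    Congruence.equality L A

end General

/-- The operation symbols of groups in additive notation. -/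
inductive GroupOp : ℕ → Type
  | zero : GroupOp 0
  | neg : GroupOp 1
  | add : GroupOp 2

/-- The language with operation symbols `+`, `-`, `0`. -/
def groupLanguage : FirstOrder.Language.{0, 0} := ⟨GroupOp, fun _ => Empty⟩

instance groupStructure (A : Type w) [AddGroup A] : groupLanguage.Structure A where
  funMap {n} f := match n, f with
    | _, GroupOp.zero => fun _ => 0
    | _, GroupOp.neg => fun x => -x 0
    | _, GroupOp.add => fun x => x 0 + x 1
  RelMap r := nomatch r

/-- The language of the expanded group `(A, +, -, 0, (f_i))`, where `L` is the language of the
additional operations `f_i`. -/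
abbrev expandedLanguage (L : FirstOrder.Language.{u, v}) : FirstOrder.Language.{u, v} := groupLanguage.sum L

/-- All nonzero elements of the abelian group `A` have the same prime order. -/
def IsElementaryAbelian (A : Type w) [AddCommGroup A] : Prop :=
  ∃ q : ℕ, q.Prime ∧ ∀ x : A, x ≠ 0 → addOrderOf x = q

/-- The vector that agrees with `a` on the coordinates in `U` and is `0` on all others. -/
def restrictTo {A : Type w} [Zero A] {n : ℕ} (a : Fin n → A) (U : Finset (Fin n)) : Fin n → A :=
  fun j => if j ∈ U then a j else 0

end UAlg

namespace UAlg

section Degree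

variable {ι M R : Type*} [DecidableEq ι]

/-! Fix `a` and regard `V ↦ F (restrictTo a V)` as `s * α` set functions with values in `ZMod p`.
Supernilpotency kills the alternating sums over the subsets of any set with more than `k` elements
(`IsSupernilpotent.sum_powerset_eq_zero`), so by Möbius inversion these functions have degree at
most `k` (`mem_degreeLE_of_sum_eq_zero`). By Fermat, the indicator of the sets on which they take
their values at `univ` is a product of factors `1 - (φ - c) ^ (p - 1)`, hence of degree at most `k *
s * α * (p - 1)`. At an inclusion-minimal such set `U` the alternating sum of the indicator is `±1`,
whereas it would vanish if `|U|` exceeded the degree (`exists_card_le_of_mem_degreeLE`). -/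

theorem sum_powerset_neg_one_pow_smul_eq_zero [AddCommGroup M] {U : Finset ι} {i : ι} (hi : i ∈ U)
    (G : Finset ι → M) (hG : ∀ V, i ∉ V → G (insert i V) = G V) :
    ∑ V ∈ U.powerset, (-1 : ℤ) ^ V.card • G V = 0 := by
  rw [← Finset.insert_erase hi, Finset.sum_powerset_insert (Finset.notMem_erase i U),
    ← Finset.sum_add_distrib]
  refine Finset.sum_eq_zero fun V hV => ?_
  have hiV : i ∉ V := fun h => Finset.notMem_erase i U (Finset.mem_powerset.1 hV h)
  rw [hG V hiV, Finset.card_insert_of_notMem hiV, pow_succ]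
  simp

theorem sum_powerset_filter_neg_one_pow {V U : Finset ι} (h : V ⊆ U) :
    ∑ T ∈ U.powerset with V ⊆ T, (-1 : ℤ) ^ T.card = if V = U then (-1) ^ U.card else 0 := by
  split_ifs with hVU
  · subst hVU
    rw [Finset.sum_eq_single V]
    · intro T hT hne
      simp only [Finset.mem_filter, Finset.mem_powerset] at hT
      exact absurd (hT.1.antisymm hT.2) hne
    · simp
  · obtain ⟨i, hiU, hiV⟩ := Finset.exists_of_ssubset (h.ssubset_of_ne hVU)
    rw [Finset.sum_filter]
    refine Eq.trans (Finset.sum_congr rfl fun T _ => ?_)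
      (sum_powerset_neg_one_pow_smul_eq_zero hiU (fun T => if V ⊆ T then (1 : ℤ) else 0)
        fun T _ => ?_)
    · simp
    · simp only [Finset.subset_insert_iff_of_notMem hiV]

theorem sum_powerset_moebius [AddCommGroup M] (φ : Finset ι → M) (U : Finset ι) :
    ∑ T ∈ U.powerset, (-1 : ℤ) ^ T.card • ∑ V ∈ T.powerset, (-1 : ℤ) ^ V.card • φ V = φ U := by
  simp only [Finset.smul_sum]
  rw [Finset.sum_comm' (t' := U.powerset) (s' := fun V => {T ∈ U.powerset | V ⊆ T})]
  · simp only [← Finset.sum_smul]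
    rw [Finset.sum_eq_single U]
    · rw [sum_powerset_filter_neg_one_pow subset_rfl, if_pos rfl, smul_smul, ← mul_pow]
      simp
    · intro V hV hne
      rw [sum_powerset_filter_neg_one_pow (Finset.mem_powerset.1 hV), if_neg hne, zero_smul]
    · simp
  · intro T V
    simp only [Finset.mem_powerset, Finset.mem_filter]
    exact ⟨fun h => ⟨h, h.2.trans h.1⟩, fun h => h.1⟩

variable (ι R) in
/-- Set functions of degree at most `d`: combinations of the monomials `U ↦ [T ⊆ U]` with
`|T| ≤ d`. -/
def degreeLE [CommRing R] (d : ℕ) : Submodule R (Finset ι → R) :=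
  Submodule.span R {g | ∃ T : Finset ι, T.card ≤ d ∧ g = fun U => if T ⊆ U then 1 else 0}

variable [CommRing R]

/-- Up to sign, the alternating sum over the subsets of `T` is the Möbius coefficient of `[T ⊆ U]`
in `φ`. -/
theorem mem_degreeLE_of_sum_eq_zero [Fintype ι] {d : ℕ} (φ : Finset ι → R)
    (h : ∀ U : Finset ι, d < U.card → ∑ V ∈ U.powerset, (-1 : ℤ) ^ V.card • φ V = 0) :
    φ ∈ degreeLE ι R d := by
  have hφ : φ = ∑ T : Finset ι, ((-1 : ℤ) ^ T.card • ∑ V ∈ T.powerset, (-1 : ℤ) ^ V.card • φ V) •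
      fun U : Finset ι => if T ⊆ U then (1 : R) else 0 := by
    funext U
    rw [Finset.sum_apply, ← sum_powerset_moebius φ U]
    simp only [Pi.smul_apply, smul_eq_mul, mul_ite, mul_one, mul_zero]
    rw [← Finset.sum_filter]
    refine Finset.sum_congr ?_ fun _ _ => rfl
    ext T
    simp
  rw [hφ]
  refine Submodule.sum_mem _ fun T _ => ?_
  by_cases hT : T.card ≤ d
  · exact Submodule.smul_mem _ _ (Submodule.subset_span ⟨T, hT, rfl⟩)
  · rw [h T (not_le.1 hT), smul_zero, zero_smul]
    exact Submodule.zero_mem _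

/-- A monomial with `|T| ≤ d` ignores some `i ∈ U`, so `V` and `insert i V` cancel. -/
theorem sum_eq_zero_of_mem_degreeLE {d : ℕ} {φ : Finset ι → R} (hφ : φ ∈ degreeLE ι R d)
    {U : Finset ι} (hU : d < U.card) : ∑ V ∈ U.powerset, (-1 : ℤ) ^ V.card • φ V = 0 := by
  induction hφ using Submodule.span_induction with
  | mem g hg =>
    obtain ⟨T, hT, rfl⟩ := hg
    obtain ⟨i, hiU, hiT⟩ := Finset.exists_mem_notMem_of_card_lt_card (hT.trans_lt hU)
    refine sum_powerset_neg_one_pow_smul_eq_zero hiU _ fun V _ => ?_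
    simp only [Finset.subset_insert_iff_of_notMem hiT]
  | zero => simp
  | add f g _ _ hf hg => simp only [Pi.add_apply, smul_add, Finset.sum_add_distrib, hf, hg, add_zero]
  | smul r f _ hf =>
    simp only [Pi.smul_apply, smul_comm _ r, ← Finset.smul_sum, hf, smul_zero]

theorem mul_mem_degreeLE {d e : ℕ} {φ ψ : Finset ι → R} (hφ : φ ∈ degreeLE ι R d)
    (hψ : ψ ∈ degreeLE ι R e) : φ * ψ ∈ degreeLE ι R (d + e) := by
  refine Submodule.mul_le.2 ?_ (Submodule.mul_mem_mul hφ hψ)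
  rw [← Submodule.mul_le, degreeLE, degreeLE, Submodule.span_mul_span]
  refine Submodule.span_le.2 ?_
  rintro _ ⟨_, ⟨S, hS, rfl⟩, _, ⟨T, hT, rfl⟩, rfl⟩
  refine Submodule.subset_span ⟨S ∪ T, (Finset.card_union_le S T).trans (by omega), ?_⟩
  funext U
  simp only [Pi.mul_apply, Finset.union_subset_iff, ite_and]
  split_ifs <;> simp

theorem one_mem_degreeLE (d : ℕ) : (1 : Finset ι → R) ∈ degreeLE ι R d :=
  Submodule.subset_span ⟨∅, by simp, by funext; simp⟩

theorem pow_mem_degreeLE {d : ℕ} {φ : Finset ι → R} (hφ : φ ∈ degreeLE ι R d) (e : ℕ) :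
    φ ^ e ∈ degreeLE ι R (d * e) := by
  induction e with
  | zero => simpa using one_mem_degreeLE 0
  | succ e ih => simpa [pow_succ, mul_add] using mul_mem_degreeLE ih hφ

theorem prod_mem_degreeLE {κ : Type*} (s : Finset κ) {d : ℕ} {φ : κ → Finset ι → R}
    (hφ : ∀ j, φ j ∈ degreeLE ι R d) : ∏ j ∈ s, φ j ∈ degreeLE ι R (s.card * d) := by
  classical
  induction s using Finset.induction_on with
  | empty => simpa using one_mem_degreeLE 0
  | insert j s hj ih =>
    rw [Finset.prod_insert hj, Finset.card_insert_of_notMem hj, add_mul, one_mul, add_comm]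
    exact mul_mem_degreeLE (hφ j) ih

/-- A system of set functions of degree at most `d` over `𝔽_p` takes each of its values on a small
set. -/
theorem exists_card_le_of_mem_degreeLE [Fintype ι] {κ : Type*} [Fintype κ] {p : ℕ}
    [Fact p.Prime] {d : ℕ} (φ : κ → Finset ι → ZMod p) (hφ : ∀ j, φ j ∈ degreeLE ι (ZMod p) d)
    (W : Finset ι) :
    ∃ U : Finset ι, U.card ≤ Fintype.card κ * (d * (p - 1)) ∧ ∀ j, φ j U = φ j W := by
  classical
  let Q : Finset ι → ZMod p := ∏ j, (1 - (φ j - φ j W • (1 : Finset ι → ZMod p)) ^ (p - 1))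
  have hQ : Q ∈ degreeLE ι (ZMod p) (Fintype.card κ * (d * (p - 1))) :=
    prod_mem_degreeLE _ fun j => Submodule.sub_mem _ (one_mem_degreeLE _)
      (pow_mem_degreeLE (Submodule.sub_mem _ (hφ j)
        (Submodule.smul_mem _ _ (one_mem_degreeLE _))) _)
  have hp : p - 1 ≠ 0 := Nat.sub_ne_zero_of_lt (Fact.out : p.Prime).one_lt
  have hQ_eq : ∀ U, Q U = if ∀ j, φ j U = φ j W then 1 else 0 := by
    intro U
    have hU : Q U = ∏ j, (1 - (φ j U - φ j W) ^ (p - 1)) := by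
      simp [Q, Finset.prod_apply]
    rw [hU]
    split_ifs with h
    · simp [h, hp]
    · push Not at h
      obtain ⟨j, hj⟩ := h
      refine Finset.prod_eq_zero (Finset.mem_univ j) ?_
      rw [ZMod.pow_card_sub_one_eq_one (sub_ne_zero.2 hj), sub_self]
  obtain ⟨U, hU, hmin⟩ := (wellFounded_lt (α := Finset ι)).has_min
    {U | ∀ j, φ j U = φ j W} ⟨W, fun _ => rfl⟩
  refine ⟨U, ?_, hU⟩
  by_contra! hcard
  have h0 := sum_eq_zero_of_mem_degreeLE hQ hcard
  -- By minimality `Q` vanishes on all proper subsets of `U`.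
  rw [Finset.sum_eq_single U] at h0
  · rw [hQ_eq, if_pos (by exact hU)] at h0
    rcases neg_one_pow_eq_or ℤ U.card with h | h <;> simp [h] at h0
  · intro V hV hne
    rw [hQ_eq, if_neg, smul_zero]
    exact fun h => hmin V h ((Finset.mem_powerset.1 hV).ssubset_of_ne hne)
  · simp

end Degree

/-! ### Polynomial functions and supernilpotency -/

section Polynomials

universe u v w

variable {L : FirstOrder.Language.{u, v}} {A : Type w}

theorem proj_mem_Pol [L.Structure A] {ι : Type} (i : ι) : (fun x : ι → A => x i) ∈ Pol L A ι :=
  ⟨FirstOrder.Language.Term.var i, fun _ => rfl⟩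

theorem comp_mem_Pol [L.Structure A] {ι κ : Type} {f : (ι → A) → A} (hf : f ∈ Pol L A ι)
    {g : ι → (κ → A) → A} (hg : ∀ i, g i ∈ Pol L A κ) :
    (fun x => f fun i => g i x) ∈ Pol L A κ := by
  obtain ⟨t, ht⟩ := hf
  choose r hr using hg
  refine ⟨t.subst r, fun x => ?_⟩
  simp only [ht, hr, FirstOrder.Language.Term.realize_subst]

theorem const_mem_Pol [L.Structure A] {ι : Type} (c : A) : (fun _ : ι → A => c) ∈ Pol L A ι :=
  ⟨(L.con c).term, fun _ => rfl⟩

variable [AddCommGroup A] [L.Structure A]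

theorem add_mem_Pol {ι : Type} {f g : (ι → A) → A} (hf : f ∈ Pol (expandedLanguage L) A ι)
    (hg : g ∈ Pol (expandedLanguage L) A ι) :
    (fun x => f x + g x) ∈ Pol (expandedLanguage L) A ι := by
  obtain ⟨t, ht⟩ := hf
  obtain ⟨r, hr⟩ := hg
  let op : ((expandedLanguage L).withConstants A).Functions 2 := Sum.inl (Sum.inl GroupOp.add)
  refine ⟨op.apply₂ t r, fun x => ?_⟩
  rw [FirstOrder.Language.Term.realize_functions_apply₂, ← ht, ← hr]
  rfl

theorem neg_mem_Pol {ι : Type} {f : (ι → A) → A} (hf : f ∈ Pol (expandedLanguage L) A ι) :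
    (fun x => -f x) ∈ Pol (expandedLanguage L) A ι := by
  obtain ⟨t, ht⟩ := hf
  let op : ((expandedLanguage L).withConstants A).Functions 1 := Sum.inl (Sum.inl GroupOp.neg)
  refine ⟨op.apply₁ t, fun x => ?_⟩
  rw [FirstOrder.Language.Term.realize_functions_apply₁, ← ht]
  rfl

theorem sum_mem_Pol {ι κ : Type} (s : Finset κ) {f : κ → (ι → A) → A}
    (hf : ∀ j, f j ∈ Pol (expandedLanguage L) A ι) :
    (fun x => ∑ j ∈ s, f j x) ∈ Pol (expandedLanguage L) A ι := by
  classical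
  induction s using Finset.induction_on with
  | empty => simpa using const_mem_Pol 0
  | insert j s hj ih => simpa only [Finset.sum_insert hj] using add_mem_Pol (hf j) ih

theorem neg_one_pow_smul_mem_Pol {ι : Type} {f : (ι → A) → A}
    (hf : f ∈ Pol (expandedLanguage L) A ι) (m : ℕ) :
    (fun x => (-1 : ℤ) ^ m • f x) ∈ Pol (expandedLanguage L) A ι := by
  rcases neg_one_pow_eq_or ℤ m with h | h
  · simpa [h] using hf
  · simpa [h] using neg_mem_Pol hf

/-- In a `k`-supernilpotent expanded group, the alternating sums of a polynomial function over the
subsets of a set with more than `k` elements vanish. -/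
theorem IsSupernilpotent.sum_powerset_eq_zero {k n : ℕ}
    (hsn : IsSupernilpotent (expandedLanguage L) A k) {f : (Fin n → A) → A}
    (hf : f ∈ Pol (expandedLanguage L) A (Fin n)) (a : Fin n → A) {U : Finset (Fin n)}
    (hU : k < U.card) : ∑ V ∈ U.powerset, (-1 : ℤ) ^ V.card • f (restrictTo a V) = 0 := by
  have hcent := centralizes_higherCommutator
    (fun _ : Fin k => Congruence.total (expandedLanguage L) A) (Congruence.total _ A)
  rw [hsn] at hcent
  -- Letting `x` vary makes the alternating sum a polynomial function that vanishes whenever some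
  -- coordinate in `U` is `0`.
  let h : (Fin n → A) → A := fun x => ∑ V ∈ U.powerset, (-1 : ℤ) ^ V.card • f (restrictTo x V)
  have hh : h ∈ Pol (expandedLanguage L) A (Fin n) := by
    refine sum_mem_Pol _ fun V => neg_one_pow_smul_mem_Pol (comp_mem_Pol hf (g := fun i x => restrictTo x V i) fun i => ?_) _
    by_cases hi : i ∈ V
    · simpa only [restrictTo, if_pos hi] using proj_mem_Pol i
    · simpa only [restrictTo, if_neg hi] using const_mem_Pol 0
  have hzero : ∀ (x : Fin n → A) (i : Fin n), i ∈ U → x i = 0 → h x = 0 := by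
    intro x i hi hx
    refine sum_powerset_neg_one_pow_smul_eq_zero hi (fun V => f (restrictTo x V)) fun V hV => ?_
    congr 1
    funext j
    by_cases hj : j = i
    · subst hj
      simp [restrictTo, hx]
    · simp [restrictTo, hj]
  -- The `k` coordinates in `S` become blocks of length 1, all others are read from the last block;
  -- `z` is a coordinate of `U` left for that block.
  obtain ⟨S, hSU, hS⟩ := Finset.exists_subset_card_eq hU.le
  obtain ⟨z, hzU, hzS⟩ := Finset.exists_mem_notMem_of_card_lt_card (hS ▸ hU)
  let e : Fin k ≃ S := (S.equivFinOfCardEq hS).symm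
  let ρ : Fin n → ((_ : Fin k) × Fin 1) ⊕ Fin n := fun j =>
    if hj : j ∈ S then Sum.inl ⟨e.symm ⟨j, hj⟩, 0⟩ else Sum.inr j
  have hρ : ∀ i, ρ (e i) = Sum.inl ⟨i, 0⟩ := fun i => by simp [ρ]
  have hρz : ρ z = Sum.inr z := by simp [ρ, hzS]
  -- Each block switches from `0` to the entries of `a`. While one of the first `k` is still `0`,
  -- both sides vanish; at the final choice, `z` makes the side with last block `0` vanish, and the
  -- other side is `h a`.
  have key := hcent (fun _ => 1) n (fun x => h fun j => x (ρ j)) (fun _ _ => 0)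
    (fun i _ => a (e i)) (fun _ => 0) a (comp_mem_Pol hh fun j => proj_mem_Pol (ρ j))
    (fun _ _ => trivial) (fun _ => trivial) ?_
  · have hb : (fun j => Sum.elim (fun q : (_ : Fin k) × Fin 1 => a (e q.1)) a (ρ j)) = a := by
      funext j
      by_cases hj : j ∈ S <;> simp [ρ, hj]
    refine Eq.trans ?_ (key.symm.trans (hzero _ z hzU ?_))
    · exact (congrArg h hb).symm
    · simp [hρz]
  · intro T hT
    obtain ⟨i, hi⟩ : ∃ i, i ∉ T := by
      by_contra! hall
      exact hT (Finset.eq_univ_iff_forall.2 hall)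
    have hiU : (e i : Fin n) ∈ U := hSU (e i).2
    exact (hzero _ _ hiU (by simp [hρ, hi])).trans (hzero _ _ hiU (by simp [hρ, hi])).symm

end Polynomials

/-! ### Coordinates on elementary abelian groups -/

theorem nonempty_addEquiv_of_card_eq_pow {A : Type*} [AddCommGroup A] [Finite A] {p α : ℕ}
    [Fact p.Prime] [Module (ZMod p) A] (hcard : Nat.card A = p ^ α) :
    Nonempty (A ≃+ (Fin α → ZMod p)) := by
  have hrank : Module.finrank (ZMod p) A = α :=
    Nat.pow_right_injective (Fact.out : p.Prime).two_le
      ((FiniteField.pow_finrank_eq_natCard p A).trans hcard)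
  exact ⟨(Module.finBasisOfFinrankEq (ZMod p) A hrank).equivFun.toAddEquiv⟩

theorem IsElementaryAbelian.nonempty_addEquiv {A : Type*} [AddCommGroup A]
    (hA : IsElementaryAbelian A) {p α : ℕ} (hp : p.Prime) (hα : 1 ≤ α)
    (hcard : Nat.card A = p ^ α) : Nonempty (A ≃+ (Fin α → ZMod p)) := by
  obtain ⟨q, hq, hord⟩ := hA
  have : Fact p.Prime := ⟨hp⟩
  have : Finite A := Nat.finite_of_card_ne_zero (by rw [hcard]; exact pow_ne_zero _ hp.ne_zero)
  -- Only a nonzero element ties `q` to `p`; it exists because `1 ≤ α`.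
  have : Nontrivial A := by
    rw [← Finite.one_lt_card_iff_nontrivial, hcard]
    exact Nat.one_lt_pow (by omega) hp.one_lt
  obtain ⟨x, hx⟩ := exists_ne (0 : A)
  have hqp : q = p := by
    refine (Nat.prime_dvd_prime_iff_eq hq hp).1 (hq.dvd_of_dvd_pow (n := α) ?_)
    rw [← hcard, ← hord x hx]
    exact addOrderOf_dvd_natCard x
  subst hqp
  let _ : Module (ZMod q) A := AddCommGroup.zmodModule fun y => by
    by_cases hy : y = 0
    · simp [hy]
    · rw [← hord y hy]
      exact addOrderOf_nsmul_eq_zero y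
  exact nonempty_addEquiv_of_card_eq_pow hcard

end UAlg

theorem mainTheorem5 {k n s α p : ℕ} (hk : 1 ≤ k) (hn : 1 ≤ n) (hs : 1 ≤ s) (hα : 1 ≤ α)
    (hp : p.Prime)
    (L : FirstOrder.Language) [L.IsAlgebraic] (A : Type*) [AddCommGroup A] [L.Structure A]
    (hA : UAlg.IsElementaryAbelian A) (hcard : Nat.card A = p ^ α)
    (hsn : UAlg.IsSupernilpotent (UAlg.expandedLanguage L) A k)
    (F : (Fin n → A) → (Fin s → A)) (hF : F ∈ UAlg.PolMap (UAlg.expandedLanguage L) A n s)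
    (a : Fin n → A) :
    ∃ U : Finset (Fin n), U.card ≤ k * s * α * (p - 1) ∧ F a = F (UAlg.restrictTo a U) := by
  have : Fact p.Prime := ⟨hp⟩
  obtain ⟨E⟩ := hA.nonempty_addEquiv hp hα hcard
  obtain ⟨U, hU, h⟩ := UAlg.exists_card_le_of_mem_degreeLE (d := k)
    (fun (j : Fin s × Fin α) V => E (F (UAlg.restrictTo a V) j.1) j.2)
    (fun j => UAlg.mem_degreeLE_of_sum_eq_zero _ fun V hV => by
      have h0 := congrArg (fun y => E y j.2) (hsn.sum_powerset_eq_zero (hF j.1) a hV)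
      simpa [map_sum, map_zsmul, Finset.sum_apply] using h0) Finset.univ
  refine ⟨U, hU.trans_eq ?_, ?_⟩
  · simp only [Fintype.card_prod, Fintype.card_fin]
    ring
  · have ha : UAlg.restrictTo a Finset.univ = a := by
      funext j
      simp [UAlg.restrictTo]
    funext r
    refine E.injective (funext fun j => ?_)
    simpa [ha] using (h (r, j)).symm
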